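/- **Theorem (complete resource pooling, integrated streaming and elastic traffic).** Consider a finite network with flow types $I$ and resources $J$ with capacities $C_j>0$; a flow of type $i$ may split its traffic over a nonempty set $J(i)\subseteq J$ of resources. For numbers of flows $N=(N_i)_{i\in I}$ the rate allocation $x(N)$ is the maximizer of $\sum_i N_iU(x_i)$ over all $x$ for which there are $x_i^j\ge 0$ ($j\in J(i)$) with $\sum_{j\in J(i)}x_i^j=x_i$ and $\sum_{i:\,j\in J(i)}N_ix_i^j\le C_j$ for all $j$ (with $x_i=0$ if $N_i=0$), where $U$ is a strictly increasing, strictly concave, differentiable function on $(0,\infty)$ and $U(0):=\lim_{x\downarrow0}U(x)\in[-\infty,\infty)$. Flow numbers $N$ are in *complete resource pooling* if there is a neighbourhood of $N$ such that $x_i(N')=\sum_{j\in J}C_j/\sum_{k\in I}N'_k$ for all $i\in I$ and all $N'$ in it. Let $\lambda_i,\mu_i,\kappa_i,\eta_i>0$ and $\rho_i=\lambda_i/\mu_i$. For $J'\subseteq J$ put $C(J')=\sum_{j\in J'}C_j$, $I(J')=\{i\in I: J(i)\subseteq J'\}$, $J'^c=J\setminus J'$ and $I(J')^c=I\setminus I(J')$.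 A nonempty $J'\subseteq J$ is *strongly connected* if there are no partition of $J'$ into nonempty sets $J_1,J_2$ and partition of $I(J')$ into (possibly empty) sets $I_1,I_2$ with $J(i)\cap J_2=\emptyset$ for $i\in I_1$ and $J(i)\cap J_1=\emptyset$ for $i\in I_2$. Assume the stability condition $\sum_{i\in I(J')}\rho_i<C(J')$ for every strongly connected $J'$. Then the fluid limit $$n_i'(t)=\lambda_i-\mu_i n_i(t)\,x_i(n(t)+m(t)),\qquad m_i'(t)=\kappa_i-\eta_i m_i(t)$$ has a unique equilibrium point $(\hat n,\hat m)$ with nonnegative entries, and $\hat n+\hat m$ is in complete resource pooling if and only if $$\sum_{i\in I(J')^c}\rho_i-C(J'^c)>-\frac{\sum_{i\in I(J')^c}\kappa_i/\eta_i}{\sum_{i\in I(J')}\kappa_i/\eta_i}\Bigl(C(J')-\sum_{i\in I(J')}\rho_i\Bigr)$$ for every strongly connected $J'\subsetneq J$ with $I(J')\neq\emptyset$. -/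

import Mathlib

open Finset Filter Topology

namespace FlowNetwork

/-- A finite multipath network whose routes have length one: flows of type `i : I` may use
exactly the resources in `res i`, and resource `j : J` has capacity `cap j`. -/
structure Network (I J : Type*) where
  res : I → Finset J
  res_nonempty : ∀ i, (res i).Nonempty
  cap : J → ℝ
  cap_pos : ∀ j, 0 < cap j

/-- A common utility function: strictly increasing, strictly concave and differentiable in the
positive rates. -/
structure IsUtility (U : ℝ → ℝ) : Prop where
  strictMonoOn : StrictMonoOn U (Set.Ioi 0)
  strictConcaveOn : StrictConcaveOn ℝ (Set.Ioi 0) U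
  differentiableOn : DifferentiableOn ℝ U (Set.Ioi 0)

/-- The utility of a nonnegative rate. At rate `0` it is the limit of `U` at `0+`, which for an
increasing `U` is the infimum over the positive rates; it may be `-∞` (as for `log`). -/
noncomputable def extUtility (U : ℝ → ℝ) (x : ℝ) : EReal :=
  if 0 < x then (U x : EReal) else ⨅ y : Set.Ioi (0 : ℝ), (U (y : ℝ) : EReal)

/-- Parameters of integrated streaming and elastic traffic: elastic flows of type `i` arrive at
rate `lam i` and have mean size `1 / mu i`; streaming flows of type `i` arrive at rate `kap i`
and have mean duration `1 / eta i`. -/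
structure Traffic (I : Type*) where
  lam : I → ℝ
  mu : I → ℝ
  kap : I → ℝ
  eta : I → ℝ
  lam_pos : ∀ i, 0 < lam i
  mu_pos : ∀ i, 0 < mu i
  kap_pos : ∀ i, 0 < kap i
  eta_pos : ∀ i, 0 < eta i

/-- The elastic load `ρ i = λ i / μ i`. -/
noncomputable def Traffic.rho {I : Type*} (T : Traffic I) (i : I) : ℝ := T.lam i / T.mu i

namespace Network

variable {I J : Type*} [Fintype I] [Fintype J] [DecidableEq I] [DecidableEq J]

/-- `C(J')`, the total capacity of a set of resources. -/
def capacity (N : Network I J) (J' : Finset J) : ℝ := ∑ j ∈ J', N.cap j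

/-- `I(J')`, the flow types all of whose resources lie in `J'`. -/
def captive (N : Network I J) (J' : Finset J) : Finset I :=
  Finset.univ.filter (fun i => N.res i ⊆ J')

/-- The pair `(I', J')` is connected: there is no partition of `J'` into nonempty `J₁`, `J₂`
with a partition of `I'` into (possibly empty) `I₁`, `I₂` such that types in `I₁` use nothing in
`J₂` and types in `I₂` use nothing in `J₁`. -/
def IsConnectedPair (N : Network I J) (I' : Finset I) (J' : Finset J) : Prop :=
  ¬ ∃ J₁ J₂ : Finset J, J₁.Nonempty ∧ J₂.Nonempty ∧ Disjoint J₁ J₂ ∧ J₁ ∪ J₂ = J' ∧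
    ∃ I₁ I₂ : Finset I, Disjoint I₁ I₂ ∧ I₁ ∪ I₂ = I' ∧
      (∀ i ∈ I₁, Disjoint (N.res i) J₂) ∧ (∀ i ∈ I₂, Disjoint (N.res i) J₁)

/-- A nonempty set `J'` of resources is strongly connected if `(I(J'), J')` is connected. -/
def IsStronglyConnected (N : Network I J) (J' : Finset J) : Prop :=
  J'.Nonempty ∧ N.IsConnectedPair (N.captive J') J'

/-- With `n i` flows of type `i`, the per-flow rates `x` are feasible: `z i j` is the rate that a
flow of type `i` receives from resource `j`. -/
def IsFeasible (N : Network I J) (n x : I → ℝ) : Prop :=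
  ∃ z : I → J → ℝ, (∀ i j, 0 ≤ z i j) ∧ (∀ i j, j ∉ N.res i → z i j = 0) ∧
    (∀ i, ∑ j, z i j = x i) ∧ (∀ j, ∑ i, n i * z i j ≤ N.cap j)

/-- Total utility `∑ n i * U (x i)`. -/
noncomputable def totalUtility (U : ℝ → ℝ) (n x : I → ℝ) : EReal :=
  ∑ i, (n i : EReal) * extUtility U (x i)

/-- `x` is the rate allocation for `n i` flows of each type `i`: it maximizes total utility among
the feasible rates, and `x i = 0` for absent types by convention. -/
def IsRateAllocation (N : Network I J) (U : ℝ → ℝ) (n x : I → ℝ) : Prop :=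
  N.IsFeasible n x ∧ (∀ y, N.IsFeasible n y → totalUtility U n y ≤ totalUtility U n x) ∧
    ∀ i, n i = 0 → x i = 0

/-- Complete resource pooling at the flow counts `n`: for all flow counts `n'` near `n`, the rate
allocation gives every type the rate `C(J) / ∑ n'`. -/
def IsCompleteResourcePooling (N : Network I J) (U : ℝ → ℝ) (n : I → ℝ) : Prop :=
  ∀ᶠ n' in 𝓝 n, ∃ x, N.IsRateAllocation U n' x ∧
    ∀ i, x i = N.capacity Finset.univ / ∑ k, n' k

/-- Stability: `∑_{I(J')} ρ < C(J')` for all strongly connected `J'`. -/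
def IsStable (N : Network I J) (T : Traffic I) : Prop :=
  ∀ J', N.IsStronglyConnected J' → ∑ i ∈ N.captive J', T.rho i < N.capacity J'

/-- `(n, m)` is an equilibrium point of the fluid limit
`n i' = λ i - μ i * n i * x i (n, m)`, `m i' = κ i - η i * m i`, where `x (n, m)` is the rate
allocation for `n i + m i` flows of each type `i`. -/
def IsFluidEquilibrium (N : Network I J) (U : ℝ → ℝ) (T : Traffic I) (n m : I → ℝ) : Prop :=
  (∀ i, 0 ≤ n i) ∧ (∀ i, 0 ≤ m i) ∧ ∃ x, N.IsRateAllocation U (n + m) x ∧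
    (∀ i, T.lam i - T.mu i * n i * x i = 0) ∧ (∀ i, T.kap i - T.eta i * m i = 0)

end Network

end FlowNetwork

/-! Because the utility is common to all types, concavity makes optimality of a positive allocation
equivalent to a condition without `U`: every usable resource is exhausted and serves only types
whose rate is lowest among those allowed to use it. This is `FairFlow` with `r = 0`
(`FairFlow.isRateAllocation` and its converse `IsRateAllocation.exists_fairFlow`).

At an equilibrium `m i = κ i / η i` and `n i * x i = ρ i`, so type `i` receives `ρ i + m i * x i` in
total. Equilibria are therefore the fair flows with fixed load `ρ` and weights `m` at positive
levels. Such a flow exists as the minimizer of a quadratic (`exists_fairFlow`), its levels are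
unique by monotonicity (`FairFlow.level_unique`), and stability makes them positive
(`FairFlow.level_pos`).

Pooling means that all levels agree, robustly. The types at the lowest level exhaust their
resources, so strict cut inequalities over proper sets `J'` force a single level
(`FairFlow.level_eq`). At a common level the cuts for `n + m` are those of `PoolingCriterion`. Both
sides of a cut are additive when `J'` disconnects, so strongly connected sets suffice
(`sum_captive_lt`). -/

set_option linter.unusedSectionVars false

namespace FlowNetwork

namespace Network

variable {I J : Type*} [Fintype I] [Fintype J] [DecidableEq I] [DecidableEq J]

/-! ### Fair flows and their perturbations -/

/-- A splitting of traffic over resources that leaves no used resource idle, in which type `i`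
receives `r i + m i * x i`, and which serves at each resource only the types whose level `x` is
lowest among those that may use it. -/
structure FairFlow (N : Network I J) (r m : I → ℝ) (y : I → J → ℝ) (x : I → ℝ) : Prop where
  nonneg : ∀ i j, 0 ≤ y i j
  support : ∀ i j, j ∉ N.res i → y i j = 0
  full : ∀ i j, j ∈ N.res i → ∑ k, y k j = N.cap j
  row : ∀ i, ∑ j, y i j = r i + m i * x i
  level_le : ∀ i j k, 0 < y i j → j ∈ N.res k → x i ≤ x k

/-- Adding `e` to the column of `y` at the resource `j`. -/
def addColumn (y : I → J → ℝ) (j : J) (e : I → ℝ) : I → J → ℝ :=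
  fun a b => y a b + if b = j then e a else 0

lemma sum_row_addColumn (y : I → J → ℝ) (j : J) (e : I → ℝ) (a : I) :
    ∑ b, addColumn y j e a b = ∑ b, y a b + e a := by
  simp [addColumn, Finset.sum_add_distrib]

lemma sum_column_addColumn (y : I → J → ℝ) (j : J) (e : I → ℝ) (b : J) :
    ∑ a, addColumn y j e a b = ∑ a, y a b + if b = j then ∑ a, e a else 0 := by
  by_cases h : b = j <;> simp [addColumn, Finset.sum_add_distrib, h]

lemma addColumn_nonneg {y : I → J → ℝ} {j : J} {e : I → ℝ} (hy : ∀ a b, 0 ≤ y a b)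
    (he : ∀ a, 0 ≤ y a j + e a) (a : I) (b : J) : 0 ≤ addColumn y j e a b := by
  by_cases h : b = j
  · subst h; simpa [addColumn] using he a
  · simpa [addColumn, h] using hy a b

lemma addColumn_support {N : Network I J} {y : I → J → ℝ} {j : J} {e : I → ℝ}
    (hy : ∀ a b, b ∉ N.res a → y a b = 0) (he : ∀ a, j ∉ N.res a → e a = 0)
    (a : I) (b : J) (hb : b ∉ N.res a) : addColumn y j e a b = 0 := by
  by_cases h : b = j
  · subst h; simp [addColumn, hy a b hb, he a hb]
  · simp [addColumn, h, hy a b hb]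

/-- Moving `δ` from type `i` to type `k`. -/
def transfer (i k : I) (δ : ℝ) : I → ℝ := Pi.single k δ - Pi.single i δ

lemma sum_transfer (i k : I) (δ : ℝ) : ∑ a, transfer i k δ a = 0 := by
  simp [transfer]

lemma transfer_left {i k : I} (h : i ≠ k) (δ : ℝ) : transfer i k δ i = -δ := by
  simp [transfer, h]

lemma transfer_right {i k : I} (h : i ≠ k) (δ : ℝ) : transfer i k δ k = δ := by
  simp [transfer, h.symm]

lemma transfer_of_ne {i k a : I} (δ : ℝ) (hi : a ≠ i) (hk : a ≠ k) : transfer i k δ a = 0 := by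
  simp [transfer, hi, hk]

lemma add_transfer_nonneg {y : I → J → ℝ} {j : J} {i k : I} {δ : ℝ} (hy : ∀ a b, 0 ≤ y a b)
    (hik : i ≠ k) (hδ : 0 ≤ δ) (hi : δ ≤ y i j) (a : I) : 0 ≤ y a j + transfer i k δ a := by
  by_cases h : a = i
  · subst h; rw [transfer_left hik]; linarith
  by_cases h' : a = k
  · subst h'; rw [transfer_right hik]; linarith [hy a j]
  · rw [transfer_of_ne δ h h']; linarith [hy a j]

lemma transfer_eq_zero {N : Network I J} {j : J} {i k : I} (δ : ℝ) (hi : j ∈ N.res i)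
    (hk : j ∈ N.res k) (a : I) (ha : j ∉ N.res a) : transfer i k δ a = 0 :=
  transfer_of_ne δ (fun h => ha (h ▸ hi)) (fun h => ha (h ▸ hk))

/-! ### Variational inequality and uniqueness of levels -/

/-- The variational inequality of a fair flow. -/
lemma FairFlow.sum_mul_le {N : Network I J} {r m x d : I → ℝ} {y y' : I → J → ℝ}
    (h : N.FairFlow r m y x) (hd : ∀ i k, x i ≤ x k → d k ≤ d i)
    (hy' : ∀ i j, 0 ≤ y' i j) (hs : ∀ i j, j ∉ N.res i → y' i j = 0)
    (hc : ∀ i j, j ∈ N.res i → 0 ≤ d i * (N.cap j - ∑ k, y' k j)) :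
    ∑ i, d i * ∑ j, y' i j ≤ ∑ i, d i * ∑ j, y i j := by
  simp only [Finset.mul_sum]
  rw [Finset.sum_comm, Finset.sum_comm (f := fun i j => d i * y i j)]
  refine Finset.sum_le_sum fun j _ => ?_
  by_cases hu : ∃ i, j ∈ N.res i
  · obtain ⟨k, hk⟩ := hu
    have hfull := h.full k j hk
    obtain ⟨i, -, hi⟩ : ∃ i ∈ Finset.univ, 0 < y i j := by
      apply Finset.exists_lt_of_sum_lt
      simpa [hfull] using N.cap_pos j
    have hir : j ∈ N.res i := by
      by_contra hn
      exact hi.ne' (h.support i j hn)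
    -- All types served at `j` share the lowest level there, hence the weight `d i`; the other types
    -- allowed at `j` have weight at most `d i` and `y a j = 0`. After summation only the slack of
    -- `y'` at `j` remains, which `hc` controls.
    have key : ∀ a, d a * y' a j - d a * y a j ≤ d i * (y' a j - y a j) := by
      intro a
      by_cases ha : j ∈ N.res a
      · have h1 := hd _ _ (h.level_le i j a hi ha)
        rcases (h.nonneg a j).eq_or_lt with h0 | h0
        · rw [← h0]; nlinarith [hy' a j]
        · rw [le_antisymm h1 (hd _ _ (h.level_le a j i h0 hir))]
          linarith
      · simp [hs a j ha, h.support a j ha]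
    have := Finset.sum_le_sum fun a (_ : a ∈ Finset.univ) => key a
    rw [Finset.sum_sub_distrib, ← Finset.mul_sum, Finset.sum_sub_distrib, hfull] at this
    linarith [hc i j hir]
  · push Not at hu
    simp [hs _ j (hu _), h.support _ j (hu _)]

/-- Testing each flow against the other with weights `-x` and `-x'` and adding leaves `∑ m i * (x i
- x' i) ^ 2 ≤ 0`. Only the levels are determined, not the splitting. -/
lemma FairFlow.level_unique {N : Network I J} {r m x x' : I → ℝ} {y y' : I → J → ℝ}
    (hm : ∀ i, 0 < m i) (h : N.FairFlow r m y x) (h' : N.FairFlow r m y' x') : x = x' := by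
  have h1 := h.sum_mul_le (d := fun i => -x i) (fun i k hik => neg_le_neg hik) h'.nonneg h'.support
    (fun i j hj => by simp [h'.full i j hj])
  have h2 := h'.sum_mul_le (d := fun i => -x' i) (fun i k hik => neg_le_neg hik) h.nonneg h.support
    (fun i j hj => by simp [h.full i j hj])
  simp only [h.row, h'.row] at h1 h2
  have h3 : ∑ i, m i * (x i - x' i) ^ 2 ≤ 0 := by
    have := add_le_add h1 h2
    rw [← Finset.sum_add_distrib, ← Finset.sum_add_distrib, ← sub_nonpos,
      ← Finset.sum_sub_distrib] at this
    refine le_of_eq_of_le (Finset.sum_congr rfl fun i _ => ?_) this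
    ring
  have h4 := (Finset.sum_eq_zero_iff_of_nonneg fun i _ =>
    mul_nonneg (hm i).le (sq_nonneg (x i - x' i))).1
    (le_antisymm h3 (Finset.sum_nonneg fun i _ => mul_nonneg (hm i).le (sq_nonneg (x i - x' i))))
  ext i
  have := h4 i (Finset.mem_univ i)
  have := (mul_eq_zero.1 this).resolve_left (hm i).ne'
  exact sub_eq_zero.1 (pow_eq_zero_iff two_ne_zero |>.1 this)

/-! ### Existence of fair flows by compactness -/

/-- The splittings that use the full capacity of every resource some type may use. -/
def fullFlows (N : Network I J) : Set (I → J → ℝ) :=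
  {y | (∀ i j, 0 ≤ y i j) ∧ (∀ i j, j ∉ N.res i → y i j = 0) ∧
    ∀ i j, j ∈ N.res i → ∑ k, y k j = N.cap j}

lemma isCompact_fullFlows (N : Network I J) : IsCompact N.fullFlows := by
  have hK : IsCompact (Set.pi Set.univ fun _ : I => Set.pi Set.univ fun j : J =>
      Set.Icc 0 (N.cap j)) :=
    isCompact_univ_pi fun _ => isCompact_univ_pi fun _ => isCompact_Icc
  refine hK.of_isClosed_subset ?_ ?_
  · have : N.fullFlows = (⋂ i, ⋂ j, {y | 0 ≤ y i j}) ∩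
        ((⋂ i, ⋂ j, ⋂ (_ : j ∉ N.res i), {y | y i j = 0}) ∩
          ⋂ i, ⋂ j, ⋂ (_ : j ∈ N.res i), {y | ∑ k, y k j = N.cap j}) := by
      ext y; simp [fullFlows]
    rw [this]
    refine IsClosed.inter ?_ (IsClosed.inter ?_ ?_)
    · exact isClosed_iInter fun i => isClosed_iInter fun j =>
        isClosed_le (by fun_prop) (by fun_prop)
    · exact isClosed_iInter fun i => isClosed_iInter fun j => isClosed_iInter fun _ =>
        isClosed_eq (by fun_prop) (by fun_prop)
    · exact isClosed_iInter fun i => isClosed_iInter fun j => isClosed_iInter fun _ =>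
        isClosed_eq (by fun_prop) (by fun_prop)
  · rintro y ⟨h0, hs, hf⟩ i - j -
    refine ⟨h0 i j, ?_⟩
    by_cases hj : j ∈ N.res i
    · rw [← hf i j hj]
      exact Finset.single_le_sum (f := fun k => y k j) (fun k _ => h0 k j) (Finset.mem_univ i)
    · rw [hs i j hj]; exact (N.cap_pos j).le

lemma fullFlows_nonempty (N : Network I J) : N.fullFlows.Nonempty := by
  have : ∀ j, ∃ f : I → ℝ, (∀ i, 0 ≤ f i) ∧ (∀ i, j ∉ N.res i → f i = 0) ∧
      ∀ i, j ∈ N.res i → ∑ k, f k = N.cap j := by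
    intro j
    by_cases hu : ∃ i, j ∈ N.res i
    · obtain ⟨i, hi⟩ := hu
      refine ⟨Pi.single i (N.cap j), fun k => ?_, fun k hk => ?_, fun k _ => by simp⟩
      · by_cases h : k = i
        · subst h; simpa using (N.cap_pos j).le
        · simp [h]
      · have : k ≠ i := fun h => hk (h ▸ hi)
        simp [this]
    · exact ⟨0, by simp, by simp, fun i hi => (hu ⟨i, hi⟩).elim⟩
  choose f hf using this
  exact ⟨fun i j => f j i, fun i j => (hf j).1 i, fun i j => (hf j).2.1 i,
    fun i j => (hf j).2.2 i⟩

/-- The level `(∑ j, y i j - r i) / m i` is half the derivative of the quadratic objective in the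
total of type `i`. At a minimizer no resource can serve a type of higher level than another
admissible type, since shifting a little traffic would lower the objective. -/
lemma exists_fairFlow (N : Network I J) (r : I → ℝ) {m : I → ℝ} (hm : ∀ i, 0 < m i) :
    ∃ y x, N.FairFlow r m y x := by
  obtain ⟨y, hy, hmin⟩ := N.isCompact_fullFlows.exists_isMinOn N.fullFlows_nonempty
    (f := fun y => ∑ i, (∑ j, y i j - r i) ^ 2 / m i) (by fun_prop)
  obtain ⟨h0, hs, hf⟩ := hy
  refine ⟨y, fun i => (∑ j, y i j - r i) / m i, h0, hs, hf, fun i => ?_, ?_⟩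
  · have := (hm i).ne'
    field_simp; ring
  intro i j k hij hjk
  by_contra! hlt
  have hir : j ∈ N.res i := by
    by_contra hn
    exact hij.ne' (hs i j hn)
  have hik : i ≠ k := by rintro rfl; exact lt_irrefl _ hlt
  set X : I → ℝ := fun a => ∑ b, y a b - r a with hX
  have hpos : 0 < 1 / m i + 1 / m k := by
    have := hm i; have := hm k; positivity
  -- Moving `δ` changes the objective by `δ` times the difference of the two sides of the last
  -- inequality, so that difference must be negative.
  obtain ⟨δ, hδ0, hδ1, hδ2⟩ : ∃ δ > 0, δ ≤ y i j ∧
      δ * (1 / m i + 1 / m k) < 2 * (X i / m i - X k / m k) := by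
    refine ⟨min (y i j) ((X i / m i - X k / m k) / (1 / m i + 1 / m k)),
      lt_min hij (div_pos (sub_pos.2 hlt) hpos), min_le_left _ _, ?_⟩
    have := mul_le_mul_of_nonneg_right (min_le_right (y i j)
      ((X i / m i - X k / m k) / (1 / m i + 1 / m k))) hpos.le
    rw [div_mul_cancel₀ _ hpos.ne'] at this
    have : 0 < X i / m i - X k / m k := sub_pos.2 hlt
    linarith
  have hmem : addColumn y j (transfer i k δ) ∈ N.fullFlows := by
    refine ⟨addColumn_nonneg h0 (add_transfer_nonneg h0 hik hδ0.le hδ1),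
      addColumn_support hs (transfer_eq_zero δ hir hjk), fun a b hb => ?_⟩
    rw [sum_column_addColumn, sum_transfer, hf a b hb]
    simp
  have hle : ∑ a, X a ^ 2 / m a ≤ ∑ a, (∑ b, addColumn y j (transfer i k δ) a b - r a) ^ 2 / m a :=
    hmin hmem
  rw [← sub_nonneg, ← Finset.sum_sub_distrib, Fintype.sum_eq_add i k hik] at hle
  · simp only [sum_row_addColumn, transfer_left hik, transfer_right hik] at hle
    have : (∑ b, y i b + -δ - r i) ^ 2 / m i - X i ^ 2 / m i +
        ((∑ b, y k b + δ - r k) ^ 2 / m k - X k ^ 2 / m k) =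
        δ * (δ * (1 / m i + 1 / m k) - 2 * (X i / m i - X k / m k)) := by
      simp only [hX]; ring
    rw [this] at hle
    exact absurd hle (not_le.2 (mul_neg_of_pos_of_neg hδ0 (sub_neg.2 hδ2)))
  · rintro a ⟨ha, hak⟩
    simp [sum_row_addColumn, transfer_of_ne δ ha hak, hX]

/-! ### Cuts at the lowest level -/

lemma FairFlow.column_le {N : Network I J} {r m x : I → ℝ} {y : I → J → ℝ}
    (h : N.FairFlow r m y x) (j : J) : ∑ i, y i j ≤ N.cap j := by
  by_cases hu : ∃ i, j ∈ N.res i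
  · obtain ⟨i, hi⟩ := hu
    exact (h.full i j hi).le
  · push Not at hu
    simpa [h.support _ j (hu _)] using (N.cap_pos j).le

lemma FairFlow.sum_le_capacity {N : Network I J} {r m x : I → ℝ} {y : I → J → ℝ}
    (h : N.FairFlow r m y x) : ∑ i, (r i + m i * x i) ≤ N.capacity univ := by
  simp only [← h.row]
  rw [Finset.sum_comm]
  exact Finset.sum_le_sum fun j _ => h.column_le j

/-- The types at the lowest level use up all resources that they may use. -/
lemma FairFlow.sum_lowest {N : Network I J} {r m x : I → ℝ} {y : I → J → ℝ}
    (h : N.FairFlow r m y x) (c : ℝ) :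
    ∑ i with x i ≤ c, (r i + m i * x i) =
      N.capacity ((univ.filter fun i => x i ≤ c).biUnion N.res) := by
  set A := univ.filter fun i => x i ≤ c with hA
  -- A resource usable by some type of `A` cannot serve a type outside `A`, whose level would be too
  -- high.
  have hcol : ∀ j, ∑ i ∈ A, y i j = if j ∈ A.biUnion N.res then N.cap j else 0 := by
    intro j
    split_ifs with hj
    · obtain ⟨k, hk, hjk⟩ := Finset.mem_biUnion.1 hj
      rw [← h.full k j hjk]
      refine Finset.sum_subset (Finset.subset_univ _) fun i _ hi => ?_
      by_contra hne
      have := h.level_le i j k ((h.nonneg i j).lt_of_ne' hne) hjk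
      simp only [hA, Finset.mem_filter, Finset.mem_univ, true_and] at hi hk
      exact hi (this.trans hk)
    · refine Finset.sum_eq_zero fun i hi => h.support i j fun hij => ?_
      exact hj (Finset.mem_biUnion.2 ⟨i, hi, hij⟩)
  simp only [← h.row]
  rw [Finset.sum_comm, Finset.sum_congr rfl fun j _ => hcol j]
  rw [Finset.sum_ite_mem, Finset.univ_inter]
  rfl

lemma subset_captive_biUnion (N : Network I J) (A : Finset I) :
    A ⊆ N.captive (A.biUnion N.res) := fun i hi => by
  simpa [captive] using Finset.subset_biUnion_of_mem N.res hi

/-- Types at nonpositive level would exhaust their resources while receiving at most their load `r`,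
against the strict cut inequality. -/
lemma FairFlow.level_pos {N : Network I J} {r m x : I → ℝ} {y : I → J → ℝ}
    (h : N.FairFlow r m y x) (hr : ∀ i, 0 ≤ r i) (hm : ∀ i, 0 < m i)
    (hst : ∀ J' : Finset J, J'.Nonempty → ∑ i ∈ N.captive J', r i < N.capacity J') (i : I) :
    0 < x i := by
  by_contra! hi
  set A := univ.filter fun i => x i ≤ 0 with hA
  have hiA : i ∈ A := by simp [hA, hi]
  have hne : (A.biUnion N.res).Nonempty := by
    obtain ⟨j, hj⟩ := N.res_nonempty i
    exact ⟨j, Finset.mem_biUnion.2 ⟨i, hiA, hj⟩⟩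
  have h1 := h.sum_lowest 0
  rw [← hA] at h1
  have h2 := hst _ hne
  have h3 : ∑ i ∈ A, r i ≤ ∑ i ∈ N.captive (A.biUnion N.res), r i :=
    Finset.sum_le_sum_of_subset_of_nonneg (N.subset_captive_biUnion A) fun i _ _ => hr i
  have h4 : ∑ i ∈ A, (r i + m i * x i) ≤ ∑ i ∈ A, r i := Finset.sum_le_sum fun a ha => by
    have : x a ≤ 0 := by simpa [hA] using ha
    nlinarith [hm a]
  linarith

/-- Let `c` be the lowest level and `A` the types attaining it. Total capacity bounds `c` from
above. If `A` exhausts only a proper set of resources, that cut bounds `c` from below, and `hcrit`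
makes the bounds incompatible. If `A` exhausts everything, no capacity is left for another type,
which would need a positive rate. -/
lemma FairFlow.level_eq {N : Network I J} {r m x : I → ℝ} {y : I → J → ℝ}
    (h : N.FairFlow r m y x) (hr : ∀ i, 0 ≤ r i) (hm : ∀ i, 0 < m i) (hx : ∀ i, 0 < x i)
    (hcrit : ∀ J' : Finset J, J'.Nonempty → J' ≠ univ →
      (∑ i ∈ N.captive J', m i) * (N.capacity univ - ∑ i, r i) <
        (∑ i, m i) * (N.capacity J' - ∑ i ∈ N.captive J', r i)) (i : I) :
    x i = (N.capacity univ - ∑ i, r i) / ∑ i, m i := by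
  obtain ⟨i₀, -, hi₀⟩ := Finset.exists_min_image univ x ⟨i, Finset.mem_univ i⟩
  have hmin : ∀ a, x i₀ ≤ x a := fun a => hi₀ a (Finset.mem_univ a)
  have hM : 0 < ∑ i, m i := Finset.sum_pos (fun i _ => hm i) ⟨i, Finset.mem_univ i⟩
  set c := x i₀ with hc
  set A := univ.filter fun i => x i ≤ c with hA
  have hmemA : ∀ a, a ∈ A → x a = c := fun a ha =>
    le_antisymm (by simpa [hA] using ha) (hmin a)
  have h1 := h.sum_lowest c
  rw [← hA] at h1
  have h2 := h.sum_le_capacity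
  have h3 : (∑ i, m i) * c ≤ N.capacity univ - ∑ i, r i := by
    rw [Finset.sum_add_distrib] at h2
    have : ∑ i, m i * c ≤ ∑ i, m i * x i :=
      Finset.sum_le_sum fun a _ => mul_le_mul_of_nonneg_left (hmin a) (hm a).le
    rw [← Finset.sum_mul] at this
    linarith
  have hAeq : ∑ i ∈ A, (r i + m i * x i) = ∑ i ∈ A, r i + (∑ i ∈ A, m i) * c := by
    rw [Finset.sum_add_distrib, Finset.sum_mul]
    congr 1
    exact Finset.sum_congr rfl fun a ha => by rw [hmemA a ha]
  by_cases hJ : A.biUnion N.res = univ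
  · have hAu : A = univ := by
      by_contra hne
      have : ∑ i ∈ A, (r i + m i * x i) < ∑ i, (r i + m i * x i) := by
        obtain ⟨a, ha⟩ : ∃ a, a ∉ A := by
          by_contra! hall
          exact hne (Finset.eq_univ_of_forall hall)
        have hp : ∀ b, 0 < r b + m b * x b := fun b =>
          add_pos_of_nonneg_of_pos (hr b) (mul_pos (hm b) (hx b))
        exact Finset.sum_lt_sum_of_subset (Finset.subset_univ _) (Finset.mem_univ a) ha (hp a)
          fun b _ _ => (hp b).le
      rw [h1, hJ] at this
      linarith
    rw [hJ, hAeq, hAu] at h1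
    rw [hmemA i (hAu ▸ Finset.mem_univ i), eq_div_iff hM.ne']
    linarith
  · exfalso
    have hne : (A.biUnion N.res).Nonempty := by
      obtain ⟨j, hj⟩ := N.res_nonempty i₀
      exact ⟨j, Finset.mem_biUnion.2 ⟨i₀, by simp [hA, hc], hj⟩⟩
    have h4 := hcrit _ hne hJ
    have hsub := N.subset_captive_biUnion A
    have h5 : ∑ i ∈ A, r i ≤ ∑ i ∈ N.captive (A.biUnion N.res), r i :=
      Finset.sum_le_sum_of_subset_of_nonneg hsub fun i _ _ => hr i
    have h6 : ∑ i ∈ A, m i ≤ ∑ i ∈ N.captive (A.biUnion N.res), m i :=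
      Finset.sum_le_sum_of_subset_of_nonneg hsub fun i _ _ => (hm i).le
    set mC := ∑ i ∈ N.captive (A.biUnion N.res), m i
    have hmC : 0 ≤ mC := Finset.sum_nonneg fun a _ => (hm a).le
    have h7 : N.capacity (A.biUnion N.res) - ∑ i ∈ N.captive (A.biUnion N.res), r i ≤ mC * c := by
      have := mul_le_mul_of_nonneg_right h6 (hx i₀).le
      linarith
    have h8 := mul_le_mul_of_nonneg_left h7 hM.le
    have h9 := mul_le_mul_of_nonneg_left h3 hmC
    linarith

/-! ### Reduction to strongly connected sets -/

/-- A strict inequality between additive set functions passes from the strongly connected sets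
to all nonempty sets of resources. -/
lemma sum_captive_lt {N : Network I J} {S : Finset J} {a : J → ℝ} {b : I → ℝ}
    (h : ∀ J' ⊆ S, N.IsStronglyConnected J' → ∑ i ∈ N.captive J', b i < ∑ j ∈ J', a j)
    (J' : Finset J) (hS : J' ⊆ S) (hne : J'.Nonempty) :
    ∑ i ∈ N.captive J', b i < ∑ j ∈ J', a j := by
  induction J' using Finset.strongInduction with
  | H J' ih =>
    by_cases hc : N.IsConnectedPair (N.captive J') J'
    · exact h J' hS ⟨hne, hc⟩
    · obtain ⟨J₁, J₂, h₁, h₂, hd, rfl, I₁, I₂, -, hI, hI₁, hI₂⟩ := not_not.1 hc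
      have hcap : N.captive (J₁ ∪ J₂) = N.captive J₁ ∪ N.captive J₂ := by
        ext i
        constructor
        · intro hi
          have hsub : N.res i ⊆ J₁ ∪ J₂ := by simpa [captive] using hi
          rw [← hI, Finset.mem_union] at hi
          rcases hi with hi | hi
          · exact Finset.mem_union_left _ (by
              simpa [captive] using (hI₁ i hi).left_le_of_le_sup_right hsub)
          · exact Finset.mem_union_right _ (by
              simpa [captive] using (hI₂ i hi).left_le_of_le_sup_left hsub)
        · simp only [captive, Finset.mem_union, Finset.mem_filter, Finset.mem_univ, true_and]
          rintro (hi | hi)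
          · exact hi.trans Finset.subset_union_left
          · exact hi.trans Finset.subset_union_right
      -- A type captive to both parts would have no resource at all.
      have hcd : Disjoint (N.captive J₁) (N.captive J₂) := by
        rw [Finset.disjoint_left]
        intro i hi hi'
        obtain ⟨j, hj⟩ := N.res_nonempty i
        simp only [captive, Finset.mem_filter, Finset.mem_univ, true_and] at hi hi'
        exact Finset.disjoint_left.1 hd (hi hj) (hi' hj)
      rw [hcap, Finset.sum_union hcd, Finset.sum_union hd]
      refine add_lt_add (ih J₁ ?_ (Finset.subset_union_left.trans hS) h₁)
        (ih J₂ ?_ (Finset.subset_union_right.trans hS) h₂)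
      · refine Finset.ssubset_iff_subset_ne.2 ⟨Finset.subset_union_left, fun he => ?_⟩
        obtain ⟨j, hj⟩ := h₂
        exact Finset.disjoint_left.1 hd (he ▸ Finset.mem_union_right _ hj) hj
      · refine Finset.ssubset_iff_subset_ne.2 ⟨Finset.subset_union_right, fun he => ?_⟩
        obtain ⟨j, hj⟩ := h₁
        exact Finset.disjoint_left.1 hd hj (he ▸ Finset.mem_union_left _ hj)

/-! ### Feasible rates and concave utilities -/

lemma extUtility_of_pos (U : ℝ → ℝ) {x : ℝ} (hx : 0 < x) : extUtility U x = (U x : EReal) :=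
  if_pos hx

lemma totalUtility_of_pos (U : ℝ → ℝ) (w : I → ℝ) {x : I → ℝ} (hx : ∀ i, 0 < x i) :
    totalUtility U w x = ((∑ i, w i * U (x i) : ℝ) : EReal) := by
  simp only [totalUtility, extUtility_of_pos U (hx _), ← EReal.coe_mul]
  exact (map_sum (⟨⟨Real.toEReal, EReal.coe_zero⟩, EReal.coe_add⟩ : ℝ →+ EReal) _ _).symm

lemma isFeasible_of_flow {N : Network I J} {w x : I → ℝ} {y : I → J → ℝ} (hw : ∀ i, 0 < w i)
    (h0 : ∀ i j, 0 ≤ y i j) (hs : ∀ i j, j ∉ N.res i → y i j = 0)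
    (hrow : ∀ i, ∑ j, y i j = w i * x i) (hcol : ∀ j, ∑ i, y i j ≤ N.cap j) :
    N.IsFeasible w x := by
  refine ⟨fun i j => y i j / w i, fun i j => div_nonneg (h0 i j) (hw i).le,
    fun i j hj => by simp [hs i j hj], fun i => ?_, fun j => ?_⟩
  · rw [← Finset.sum_div, hrow, mul_div_cancel_left₀ _ (hw i).ne']
  · simpa only [mul_div_cancel₀ _ (hw _).ne'] using hcol j

lemma IsFeasible.exists_flow {N : Network I J} {w x : I → ℝ} (hw : ∀ i, 0 < w i)
    (h : N.IsFeasible w x) : ∃ y : I → J → ℝ, (∀ i j, 0 ≤ y i j) ∧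
      (∀ i j, j ∉ N.res i → y i j = 0) ∧ (∀ i, ∑ j, y i j = w i * x i) ∧
      ∀ j, ∑ i, y i j ≤ N.cap j := by
  obtain ⟨z, h0, hs, hrow, hcol⟩ := h
  exact ⟨fun i j => w i * z i j, fun i j => mul_nonneg (hw i).le (h0 i j),
    fun i j hj => by simp [hs i j hj], fun i => by rw [← Finset.mul_sum, hrow], hcol⟩

lemma IsFeasible.nonneg {N : Network I J} {w x : I → ℝ} (h : N.IsFeasible w x) (i : I) :
    0 ≤ x i := by
  obtain ⟨z, h0, -, hrow, -⟩ := h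
  exact hrow i ▸ Finset.sum_nonneg fun j _ => h0 i j

lemma IsFeasible.sum_captive_le {N : Network I J} {w x : I → ℝ} (hw : ∀ i, 0 < w i)
    (h : N.IsFeasible w x) (J' : Finset J) :
    ∑ i ∈ N.captive J', w i * x i ≤ N.capacity J' := by
  obtain ⟨y, h0, hs, hrow, hcol⟩ := h.exists_flow hw
  calc ∑ i ∈ N.captive J', w i * x i = ∑ i ∈ N.captive J', ∑ j ∈ J', y i j := by
        refine Finset.sum_congr rfl fun i hi => ?_
        rw [← hrow i]
        refine (Finset.sum_subset (Finset.subset_univ _) fun j _ hj => hs i j fun hij => ?_).symm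
        have : N.res i ⊆ J' := by simpa [captive] using hi
        exact hj (this hij)
    _ = ∑ j ∈ J', ∑ i ∈ N.captive J', y i j := Finset.sum_comm
    _ ≤ ∑ j ∈ J', N.cap j := Finset.sum_le_sum fun j _ =>
        (Finset.sum_le_sum_of_subset_of_nonneg (Finset.subset_univ _) fun i _ _ => h0 i j).trans
          (hcol j)

end Network

lemma IsUtility.le_tangent {U : ℝ → ℝ} (hU : IsUtility U) {x y : ℝ} (hx : 0 < x) (hy : 0 < y) :
    U y ≤ U x + deriv U x * (y - x) := by
  have hd : DifferentiableAt ℝ U x := hU.differentiableOn.differentiableAt (Ioi_mem_nhds hx)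
  have hc := hU.strictConcaveOn.concaveOn
  rcases lt_trichotomy x y with h | rfl | h
  · have := hc.slope_le_deriv hx hy h hd
    rw [slope_def_field, div_le_iff₀ (sub_pos.2 h)] at this
    linarith
  · simp
  · have := hc.deriv_le_slope hy hx h hd
    rw [slope_def_field, le_div_iff₀ (sub_pos.2 h)] at this
    linarith

lemma IsUtility.deriv_nonneg {U : ℝ → ℝ} (hU : IsUtility U) {x : ℝ} (hx : 0 < x) :
    0 ≤ deriv U x := by
  have h1 := hU.le_tangent hx (y := x + 1) (by linarith)
  have h2 := hU.strictMonoOn (a := x) (b := x + 1) hx (by simp; linarith) (by linarith)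
  linarith

lemma IsUtility.deriv_anti {U : ℝ → ℝ} (hU : IsUtility U) {x y : ℝ} (hx : 0 < x) (hxy : x ≤ y) :
    deriv U y ≤ deriv U x := by
  rcases hxy.eq_or_lt with rfl | h
  · rfl
  have h1 := hU.le_tangent hx (hx.trans h)
  have h2 := hU.le_tangent (hx.trans h) hx
  by_contra! hlt
  nlinarith [mul_pos (sub_pos.2 hlt) (sub_pos.2 h)]

lemma IsUtility.extUtility_le_tangent {U : ℝ → ℝ} (hU : IsUtility U) {x y : ℝ} (hx : 0 < x)
    (hy : 0 ≤ y) : extUtility U y ≤ ((U x + deriv U x * (y - x) : ℝ) : EReal) := by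
  rcases hy.eq_or_lt with rfl | hy
  · rw [extUtility, if_neg (lt_irrefl _)]
    -- At rate `0` the infimum lies below every tangent bound at positive `y`, hence below their
    -- limit.
    have hcont : Tendsto (fun y : ℝ => ((U x + deriv U x * (y - x) : ℝ) : EReal)) (𝓝[>] 0)
        (𝓝 ((U x + deriv U x * (0 - x) : ℝ) : EReal)) := by
      refine (continuous_coe_real_ereal.tendsto _).comp ?_
      exact (Continuous.tendsto (by fun_prop) 0).mono_left nhdsWithin_le_nhds
    refine ge_of_tendsto hcont ?_
    filter_upwards [self_mem_nhdsWithin] with y hy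
    exact (iInf_le _ (⟨y, hy⟩ : Set.Ioi (0 : ℝ))).trans
      (EReal.coe_le_coe_iff.2 (hU.le_tangent hx hy))
  · rw [extUtility, if_pos hy]
    exact EReal.coe_le_coe_iff.2 (hU.le_tangent hx hy)

/-- Moving two rates towards each other raises the sum of their utilities. -/
lemma IsUtility.transfer_gain {U : ℝ → ℝ} (hU : IsUtility U) {a b c d v w δ : ℝ} (ha : 0 < a)
    (hv : 0 < v) (hw : 0 < w) (hδ : 0 < δ) (hb : b = a + δ / v) (hc : c = d - δ / w)
    (hbc : b < c) : 0 < w * (U c - U d) + v * (U b - U a) := by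
  have hab : a < b := by rw [hb]; have := div_pos hδ hv; linarith
  have hcd : c < d := by rw [hc]; have := div_pos hδ hw; linarith
  have h1 := hU.strictConcaveOn.slope_anti_adjacent (x := a) (y := b) (z := c) ha
    (ha.trans (hab.trans hbc)) hab hbc
  have h2 := hU.strictConcaveOn.slope_anti_adjacent (x := b) (y := c) (z := d) (ha.trans hab)
    (ha.trans (hab.trans (hbc.trans hcd))) hbc hcd
  have h3 := h2.trans h1
  have e1 : b - a = δ / v := by rw [hb]; ring
  have e2 : d - c = δ / w := by rw [hc]; ring
  rw [e1, e2, div_lt_div_iff₀ (div_pos hδ hw) (div_pos hδ hv)] at h3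
  -- The factor `v * w / δ` turns the comparison of outer slopes into one of weighted utility gains.
  have h4 : (U d - U c) * (δ / v) * (v * w / δ) < (U b - U a) * (δ / w) * (v * w / δ) :=
    mul_lt_mul_of_pos_right h3 (by positivity)
  have e3 : (U d - U c) * (δ / v) * (v * w / δ) = (U d - U c) * w := by
    field_simp
  have e4 : (U b - U a) * (δ / w) * (v * w / δ) = (U b - U a) * v := by
    field_simp
  rw [e3, e4] at h4
  linarith

namespace Network

variable {I J : Type*} [Fintype I] [Fintype J] [DecidableEq I] [DecidableEq J]

/-! ### Rate allocations are fair flows -/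

lemma FairFlow.isRateAllocation {N : Network I J} {U : ℝ → ℝ} (hU : IsUtility U) {w x : I → ℝ}
    {y : I → J → ℝ} (hw : ∀ i, 0 < w i) (hx : ∀ i, 0 < x i) (h : N.FairFlow 0 w y x) :
    N.IsRateAllocation U w x := by
  have hrow : ∀ i, ∑ j, y i j = w i * x i := fun i => by simp [h.row i]
  refine ⟨isFeasible_of_flow hw h.nonneg h.support hrow h.column_le, fun x' hx' => ?_,
    fun i hi => absurd hi (hw i).ne'⟩
  obtain ⟨y', h0, hs, hrow', hcol⟩ := hx'.exists_flow hw
  -- The marginal utilities are admissible weights: antitone in the level by concavity, and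
  -- nonnegative, so unused capacity is harmless.
  have hvar := h.sum_mul_le (d := fun i => deriv U (x i))
    (fun i k hik => hU.deriv_anti (hx i) hik) h0 hs
    (fun i j _ => mul_nonneg (hU.deriv_nonneg (hx i)) (sub_nonneg.2 (hcol j)))
  simp only [hrow, hrow'] at hvar
  rw [totalUtility_of_pos U w hx]
  calc totalUtility U w x'
      ≤ ∑ i, ((w i * (U (x i) + deriv U (x i) * (x' i - x i)) : ℝ) : EReal) := by
        refine Finset.sum_le_sum fun i _ => ?_
        rw [EReal.coe_mul]
        exact mul_le_mul_of_nonneg_left (hU.extUtility_le_tangent (hx i) (hx'.nonneg i))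
          (EReal.coe_nonneg.2 (hw i).le)
    _ = ((∑ i, w i * (U (x i) + deriv U (x i) * (x' i - x i)) : ℝ) : EReal) :=
        (map_sum (⟨⟨Real.toEReal, EReal.coe_zero⟩, EReal.coe_add⟩ : ℝ →+ EReal) _ _).symm
    _ ≤ ((∑ i, w i * U (x i) : ℝ) : EReal) := by
        refine EReal.coe_le_coe_iff.2 ?_
        rw [← sub_nonpos, ← Finset.sum_sub_distrib] at hvar ⊢
        refine le_of_eq_of_le (Finset.sum_congr rfl fun i _ => ?_) hvar
        ring

lemma IsRateAllocation.sum_utility_le {N : Network I J} {U : ℝ → ℝ} {w x x' : I → ℝ}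
    (h : N.IsRateAllocation U w x) (hx : ∀ i, 0 < x i) (hx' : ∀ i, 0 < x' i)
    (hf : N.IsFeasible w x') : ∑ i, w i * (U (x' i) - U (x i)) ≤ 0 := by
  have := h.2.1 x' hf
  rw [totalUtility_of_pos U w hx, totalUtility_of_pos U w hx', EReal.coe_le_coe_iff] at this
  simp only [mul_sub, Finset.sum_sub_distrib]
  linarith

/-- Two perturbations would improve an unfair allocation: giving idle capacity to a type that may
use it, by monotonicity, and moving traffic from a higher to a lower rate, by strict concavity. -/
lemma IsRateAllocation.exists_fairFlow {N : Network I J} {U : ℝ → ℝ} (hU : IsUtility U)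
    {w x : I → ℝ} (hw : ∀ i, 0 < w i) (hx : ∀ i, 0 < x i) (h : N.IsRateAllocation U w x) :
    ∃ y, N.FairFlow 0 w y x := by
  obtain ⟨y, h0, hs, hrow, hcol⟩ := h.1.exists_flow hw
  have hrow' : ∀ j e i, ∑ b, addColumn y j e i b = w i * (x i + e i / w i) := fun j e i => by
    rw [sum_row_addColumn, hrow, mul_add, mul_div_cancel₀ _ (hw i).ne']
  refine ⟨y, h0, hs, fun i j hj => le_antisymm (hcol j) ?_, fun i => by simp [hrow i], ?_⟩
  · by_contra! hlt
    set δ := N.cap j - ∑ k, y k j with hδ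
    have hδ0 : 0 < δ := sub_pos.2 hlt
    have he : ∀ a, 0 ≤ (Pi.single i δ : I → ℝ) a := fun a =>
      (Pi.single_nonneg.2 hδ0.le : (0 : I → ℝ) ≤ Pi.single i δ) a
    have hf : N.IsFeasible w fun a => x a + (Pi.single i δ : I → ℝ) a / w a := by
      refine isFeasible_of_flow hw
        (addColumn_nonneg (j := j) h0 fun a => add_nonneg (h0 a j) (he a))
        (addColumn_support hs fun a ha => ?_) (hrow' j _) fun b => ?_
      · have : a ≠ i := by rintro rfl; exact ha hj
        simp [this]
      · rw [sum_column_addColumn]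
        split_ifs with hb
        · subst hb; simp [hδ]
        · simpa using hcol b
    have hle := h.sum_utility_le hx
      (fun a => add_pos_of_pos_of_nonneg (hx a) (div_nonneg (he a) (hw a).le)) hf
    rw [Finset.sum_eq_single i (fun a _ ha => by simp [ha]) (by simp)] at hle
    have hlt' : x i < x i + δ / w i := by have := div_pos hδ0 (hw i); linarith
    have := hU.strictMonoOn (hx i) ((hx i).trans hlt') hlt'
    simp only [Pi.single_eq_same] at hle
    nlinarith [mul_pos (hw i) (sub_pos.2 this)]
  · intro i j k hij hjk
    by_contra! hlt
    have hir : j ∈ N.res i := by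
      by_contra hn
      exact hij.ne' (hs i j hn)
    have hik : i ≠ k := by rintro rfl; exact lt_irrefl _ hlt
    have hpos : 0 < 1 / w i + 1 / w k := by
      have := hw i; have := hw k; positivity
    -- The bound keeps the two rates in order after the transfer, as `IsUtility.transfer_gain`
    -- requires.
    obtain ⟨δ, hδ0, hδ1, hδ2⟩ : ∃ δ > 0, δ ≤ y i j ∧ δ * (1 / w i + 1 / w k) < x i - x k := by
      have hgap : 0 < x i - x k := sub_pos.2 hlt
      refine ⟨min (y i j) ((x i - x k) / 2 / (1 / w i + 1 / w k)),
        lt_min hij (by positivity), min_le_left _ _, ?_⟩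
      have := mul_le_mul_of_nonneg_right (min_le_right (y i j)
        ((x i - x k) / 2 / (1 / w i + 1 / w k))) hpos.le
      rw [div_mul_cancel₀ _ hpos.ne'] at this
      linarith
    have hgap : x k + δ / w k < x i - δ / w i := by
      have : δ * (1 / w i + 1 / w k) = δ / w i + δ / w k := by ring
      linarith
    have hk' : x k < x k + δ / w k := by have := div_pos hδ0 (hw k); linarith
    have hf : N.IsFeasible w fun a => x a + transfer i k δ a / w a := by
      refine isFeasible_of_flow hw
        (addColumn_nonneg h0 (add_transfer_nonneg h0 hik hδ0.le hδ1))
        (addColumn_support hs (transfer_eq_zero δ hir hjk)) (hrow' j _) fun b => ?_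
      rw [sum_column_addColumn, sum_transfer]
      simpa using hcol b
    have hle := h.sum_utility_le hx (fun a => ?_) hf
    · rw [Fintype.sum_eq_add i k hik] at hle
      · rw [transfer_left hik, transfer_right hik, neg_div, ← sub_eq_add_neg] at hle
        exact absurd hle (not_le.2 (hU.transfer_gain (hx k) (hw k) (hw i) hδ0 rfl rfl hgap))
      · rintro a ⟨ha, hak⟩
        simp [transfer_of_ne δ ha hak]
    · by_cases ha : a = i
      · subst ha
        rw [transfer_left hik, neg_div, ← sub_eq_add_neg]
        exact (hx k).trans (hk'.trans hgap)
      by_cases hak : a = k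
      · subst hak
        rw [transfer_right hik]
        exact (hx a).trans hk'
      · simpa [transfer_of_ne δ ha hak] using hx a

/-- This exchanges the two readings of an equilibrium: `n i + m i` flows without fixed load, or `m
i` flows on top of the load `ρ i`. -/
lemma FairFlow.of_row {N : Network I J} {r m r' m' x : I → ℝ} {y : I → J → ℝ}
    (h : N.FairFlow r m y x) (hrow : ∀ i, r i + m i * x i = r' i + m' i * x i) :
    N.FairFlow r' m' y x :=
  ⟨h.nonneg, h.support, h.full, fun i => (h.row i).trans (hrow i), h.level_le⟩

/-- Feasibility of the pooled rates gives weak cut inequalities, and their validity on a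
neighbourhood makes them strict. Conversely strict cuts persist nearby, where `FairFlow.level_eq`
with `r = 0` applies. -/
lemma isCompleteResourcePooling_iff [Nonempty I] (N : Network I J) {U : ℝ → ℝ}
    (hU : IsUtility U) {w : I → ℝ} (hw : ∀ i, 0 < w i) :
    N.IsCompleteResourcePooling U w ↔ ∀ J' : Finset J, J'.Nonempty → J' ≠ univ →
      (∑ i ∈ N.captive J', w i) * N.capacity univ < (∑ i, w i) * N.capacity J' := by
  have hpos : ∀ᶠ w' in 𝓝 w, ∀ i, 0 < w' i :=
    eventually_all.2 fun i => (continuous_apply i).continuousAt.eventually_const_lt (hw i)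
  have hcappos : ∀ J' : Finset J, J'.Nonempty → 0 < N.capacity J' := fun J' hne =>
    Finset.sum_pos (fun j _ => N.cap_pos j) hne
  have hsum : ∀ v : I → ℝ, (∀ i, 0 < v i) → 0 < ∑ i, v i := fun v hv =>
    Finset.sum_pos (fun i _ => hv i) Finset.univ_nonempty
  constructor
  · intro h J' hne hJ
    have hle : ∀ᶠ w' in 𝓝 w,
        (∑ i ∈ N.captive J', w' i) * N.capacity univ ≤ (∑ i, w' i) * N.capacity J' := by
      filter_upwards [h, hpos] with w' ⟨x, hx, hxc⟩ hw'
      have := hx.1.sum_captive_le hw' J'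
      simp only [hxc, ← Finset.sum_mul] at this
      rw [← mul_div_assoc, div_le_iff₀ (hsum w' hw')] at this
      linarith
    rcases (N.captive J').eq_empty_or_nonempty with he | ⟨i, hi⟩
    · rw [he, Finset.sum_empty, zero_mul]
      exact mul_pos (hsum w hw) (hcappos J' hne)
    · have hlt : N.capacity J' < N.capacity univ := by
        obtain ⟨j, hj⟩ : ∃ j, j ∉ J' := by
          by_contra! hall
          exact hJ (Finset.eq_univ_of_forall hall)
        exact Finset.sum_lt_sum_of_subset (Finset.subset_univ _) (Finset.mem_univ j) hj
          (N.cap_pos j) fun j _ _ => (N.cap_pos j).le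
      -- Adding `ε` flows of a captive type raises the left side by `ε * C(J)` and the right only by
      -- `ε * C(J')`, so a weak inequality there is strict at `w`.
      have ht : Tendsto (fun ε : ℝ => w + Pi.single i ε) (𝓝[>] 0) (𝓝 w) := by
        have hc : Continuous fun ε : ℝ => w + (Pi.single i ε : I → ℝ) :=
          continuous_const.add (continuous_single (A := fun _ : I => ℝ) i)
        have := (hc.tendsto 0).mono_left (nhdsWithin_le_nhds (s := Set.Ioi (0 : ℝ)))
        simpa using this
      obtain ⟨ε, hε, hε0⟩ := ((ht.eventually hle).and self_mem_nhdsWithin).exists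
      simp only [Pi.add_apply, Finset.sum_add_distrib, Finset.sum_pi_single', hi, if_true,
        Finset.mem_univ] at hε
      have : 0 < ε * (N.capacity univ - N.capacity J') := mul_pos hε0 (sub_pos.2 hlt)
      linarith
  · intro h
    have hlt : ∀ᶠ w' in 𝓝 w, ∀ J' : Finset J, J'.Nonempty → J' ≠ univ →
        (∑ i ∈ N.captive J', w' i) * N.capacity univ < (∑ i, w' i) * N.capacity J' := by
      refine eventually_all.2 fun J' => ?_
      by_cases hJ : J'.Nonempty ∧ J' ≠ univ
      · have hc1 : Continuous fun w' : I → ℝ => (∑ i ∈ N.captive J', w' i) * N.capacity univ := by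
          fun_prop
        have hc2 : Continuous fun w' : I → ℝ => (∑ i, w' i) * N.capacity J' := by fun_prop
        filter_upwards [hc1.continuousAt.eventually_lt hc2.continuousAt (h J' hJ.1 hJ.2)] with
          w' hw' _ _ using hw'
      · exact Eventually.of_forall fun w' h1 h2 => absurd ⟨h1, h2⟩ hJ
    filter_upwards [hlt, hpos] with w' hlt hw'
    obtain ⟨y, x, hy⟩ := N.exists_fairFlow 0 hw'
    have hx := hy.level_pos (fun _ => le_rfl) hw' (fun J' hne => by simpa using hcappos J' hne)
    refine ⟨x, hy.isRateAllocation hU hw' hx, fun i => ?_⟩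
    simpa using hy.level_eq (fun _ => le_rfl) hw' hx (by simpa using hlt) i

end Network

/-! ### Equilibria of the fluid limit -/

lemma Traffic.rho_pos {I : Type*} (T : Traffic I) (i : I) : 0 < T.rho i :=
  div_pos (T.lam_pos i) (T.mu_pos i)

/-- The mean number of streaming flows in equilibrium. -/
noncomputable def Traffic.streams {I : Type*} (T : Traffic I) (i : I) : ℝ :=
  T.kap i / T.eta i

lemma Traffic.streams_pos {I : Type*} (T : Traffic I) (i : I) :
    0 < T.streams i :=
  div_pos (T.kap_pos i) (T.eta_pos i)

namespace Network

variable {I J : Type*} [Fintype I] [Fintype J] [DecidableEq I] [DecidableEq J]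

lemma IsStable.sum_lt {N : Network I J} {T : Traffic I} (h : N.IsStable T) (J' : Finset J)
    (hne : J'.Nonempty) : ∑ i ∈ N.captive J', T.rho i < N.capacity J' :=
  sum_captive_lt (S := univ) (a := N.cap) (fun J' _ => h J') J' (Finset.subset_univ _) hne

lemma FairFlow.isFluidEquilibrium {N : Network I J} {U : ℝ → ℝ} (hU : IsUtility U)
    {T : Traffic I} {x : I → ℝ} {y : I → J → ℝ} (h : N.FairFlow T.rho T.streams y x)
    (hx : ∀ i, 0 < x i) : N.IsFluidEquilibrium U T (fun i => T.rho i / x i) T.streams := by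
  have hn : ∀ i, 0 < T.rho i / x i := fun i => div_pos (T.rho_pos i) (hx i)
  refine ⟨fun i => (hn i).le, fun i => (T.streams_pos i).le, x, ?_, fun i => ?_, fun i => ?_⟩
  · refine FairFlow.isRateAllocation hU (fun i => add_pos (hn i) (T.streams_pos i)) hx
      (h.of_row fun i => ?_)
    have := (hx i).ne'
    simp only [Pi.zero_apply, Pi.add_apply]
    field_simp
    ring
  · have := (hx i).ne'
    have := (T.mu_pos i).ne'
    simp only [Traffic.rho]
    field_simp
    ring
  · have := (T.eta_pos i).ne'
    simp only [Traffic.streams]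
    field_simp
    ring

lemma IsFluidEquilibrium.exists_fairFlow {N : Network I J} {U : ℝ → ℝ} (hU : IsUtility U)
    {T : Traffic I} {n m : I → ℝ} (h : N.IsFluidEquilibrium U T n m) :
    ∃ y x, N.FairFlow T.rho T.streams y x ∧ (∀ i, 0 < x i) ∧ N.IsRateAllocation U (n + m) x ∧
      n = (fun i => T.rho i / x i) ∧ m = T.streams := by
  obtain ⟨hn, -, x, hx, hlam, hkap⟩ := h
  have hm : m = T.streams := by
    ext i
    rw [Traffic.streams, eq_div_iff (T.eta_pos i).ne']
    linarith [hkap i]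
  have hnx : ∀ i, n i * x i = T.rho i := fun i => by
    rw [Traffic.rho, eq_div_iff (T.mu_pos i).ne']
    linarith [hlam i]
  have hx0 : ∀ i, 0 < x i := fun i =>
    pos_of_mul_pos_right (by rw [hnx]; exact T.rho_pos i) (hn i)
  have hw : ∀ i, 0 < (n + m) i := fun i =>
    add_pos_of_nonneg_of_pos (hn i) (by rw [hm]; exact T.streams_pos i)
  obtain ⟨y, hy⟩ := hx.exists_fairFlow hU hw hx0
  refine ⟨y, x, hy.of_row fun i => ?_, hx0, hx, ?_, hm⟩
  · simp only [Pi.zero_apply, Pi.add_apply, hm, add_mul, hnx, zero_add]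
  · ext i
    rw [eq_div_iff (hx0 i).ne', hnx]

lemma IsStable.existsUnique_equilibrium {N : Network I J} {U : ℝ → ℝ} (hU : IsUtility U)
    {T : Traffic I} (hstab : N.IsStable T) :
    ∃! s : (I → ℝ) × (I → ℝ), N.IsFluidEquilibrium U T s.1 s.2 := by
  obtain ⟨y, x, h⟩ := N.exists_fairFlow T.rho T.streams_pos
  have hx := h.level_pos (fun i => (T.rho_pos i).le) T.streams_pos hstab.sum_lt
  refine ⟨(fun i => T.rho i / x i, T.streams), h.isFluidEquilibrium hU hx, ?_⟩
  rintro ⟨n, m⟩ hs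
  obtain ⟨y', x', h', -, -, hn, hm⟩ := hs.exists_fairFlow hU
  dsimp only at hn hm
  rw [hn, hm, h'.level_unique T.streams_pos h]

/-! ### The pooling criterion at equilibrium -/

/-- The criterion for a fair flow to have a common level. -/
def PoolingCriterion (N : Network I J) (T : Traffic I) : Prop :=
  ∀ J' : Finset J, J'.Nonempty → J' ≠ univ →
    (∑ i ∈ N.captive J', T.streams i) * (N.capacity univ - ∑ i, T.rho i) <
      (∑ i, T.streams i) * (N.capacity J' - ∑ i ∈ N.captive J', T.rho i)

/-- Either side forces a common level `c`: pooling through uniqueness of levels, the criterion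
through `FairFlow.level_eq`. At a common level the total rate of any set of types is its load plus
`c` times its streams, so the two families of cuts coincide. -/
lemma IsFluidEquilibrium.isCompleteResourcePooling_iff [Nonempty I] {N : Network I J}
    {U : ℝ → ℝ} (hU : IsUtility U) {T : Traffic I} {n m : I → ℝ}
    (h : N.IsFluidEquilibrium U T n m) :
    N.IsCompleteResourcePooling U (n + m) ↔ N.PoolingCriterion T := by
  obtain ⟨y, x, hy, hx, hra, hn, hm⟩ := h.exists_fairFlow hU
  have hw : ∀ i, 0 < (n + m) i := fun i => by
    rw [hn, hm]
    exact add_pos (div_pos (T.rho_pos i) (hx i)) (T.streams_pos i)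
  have hwx : ∀ i, (n + m) i * x i = T.rho i + T.streams i * x i := fun i => by
    simp only [hn, hm, Pi.add_apply, add_mul, div_mul_cancel₀ _ (hx i).ne']
  have hM : 0 < ∑ i, T.streams i :=
    Finset.sum_pos (fun i _ => T.streams_pos i) Finset.univ_nonempty
  have hW : 0 < ∑ i, (n + m) i := Finset.sum_pos (fun i _ => hw i) Finset.univ_nonempty
  have hC : 0 < N.capacity univ := by
    obtain ⟨j, -⟩ := N.res_nonempty (Classical.arbitrary I)
    exact Finset.sum_pos (fun j _ => N.cap_pos j) ⟨j, Finset.mem_univ j⟩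
  have key : ∀ c, 0 < c → (∀ i, x i = c) → c * (∑ i, (n + m) i) = N.capacity univ →
      (N.IsCompleteResourcePooling U (n + m) ↔ N.PoolingCriterion T) := by
    intro c hc hxc hcW
    have hsum : ∀ A : Finset I,
        (∑ i ∈ A, (n + m) i) * c = ∑ i ∈ A, T.rho i + (∑ i ∈ A, T.streams i) * c := fun A => by
      rw [Finset.sum_mul, Finset.sum_mul, ← Finset.sum_add_distrib]
      exact Finset.sum_congr rfl fun i _ => by simpa only [hxc] using hwx i
    have hS : N.capacity univ - ∑ i, T.rho i = (∑ i, T.streams i) * c := by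
      linarith [hsum univ]
    rw [N.isCompleteResourcePooling_iff hU hw, PoolingCriterion]
    refine forall₃_congr fun J' _ _ => ?_
    rw [hS, ← hcW]
    have e1 : (∑ i ∈ N.captive J', (n + m) i) * (c * ∑ i, (n + m) i) =
        (∑ i, (n + m) i) * ((∑ i ∈ N.captive J', (n + m) i) * c) := by ring
    have e2 : (∑ i ∈ N.captive J', T.streams i) * ((∑ i, T.streams i) * c) =
        (∑ i, T.streams i) * ((∑ i ∈ N.captive J', T.streams i) * c) := by ring
    rw [e1, e2, mul_lt_mul_iff_right₀ hW, mul_lt_mul_iff_right₀ hM, hsum, lt_sub_iff_add_lt']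
  by_cases hcrp : N.IsCompleteResourcePooling U (n + m)
  · obtain ⟨x', hx', hxc⟩ := hcrp.self_of_nhds
    have hc : 0 < N.capacity univ / ∑ i, (n + m) i := div_pos hC hW
    obtain ⟨y₁, h₁⟩ := hx'.exists_fairFlow hU hw fun i => hxc i ▸ hc
    obtain ⟨y₂, h₂⟩ := hra.exists_fairFlow hU hw hx
    refine key _ hc (fun i => ?_) (div_mul_cancel₀ _ hW.ne')
    rw [← hxc i, h₁.level_unique hw h₂]
  · by_cases hcrit : N.PoolingCriterion T
    · have hxc := hy.level_eq (fun i => (T.rho_pos i).le) T.streams_pos hx hcrit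
      have hc := hx (Classical.arbitrary I)
      rw [hxc] at hc
      refine key _ hc hxc ?_
      have h1 : ∑ i, (n + m) i * x i = ∑ i, (T.rho i + T.streams i * x i) :=
        Finset.sum_congr rfl fun i _ => hwx i
      simp only [hxc] at h1
      rw [← Finset.sum_mul, Finset.sum_add_distrib, ← Finset.sum_mul,
        mul_div_cancel₀ _ hM.ne'] at h1
      linarith
    · exact iff_of_false hcrp hcrit

lemma poolingCriterion_iff [Nonempty I] (N : Network I J) (T : Traffic I) :
    N.PoolingCriterion T ↔ ∀ J' : Finset J, N.IsStronglyConnected J' → J' ≠ univ →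
      (N.captive J').Nonempty →
        (∑ i ∈ (N.captive J')ᶜ, T.rho i) - N.capacity J'ᶜ >
          -((∑ i ∈ (N.captive J')ᶜ, T.kap i / T.eta i) /
              (∑ i ∈ N.captive J', T.kap i / T.eta i)) *
            (N.capacity J' - ∑ i ∈ N.captive J', T.rho i) := by
  have hM : 0 < ∑ i, T.streams i :=
    Finset.sum_pos (fun i _ => T.streams_pos i) Finset.univ_nonempty
  have hform : ∀ J' : Finset J, (N.captive J').Nonempty →
      ((∑ i ∈ (N.captive J')ᶜ, T.rho i) - N.capacity J'ᶜ >
          -((∑ i ∈ (N.captive J')ᶜ, T.kap i / T.eta i) /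
              (∑ i ∈ N.captive J', T.kap i / T.eta i)) *
            (N.capacity J' - ∑ i ∈ N.captive J', T.rho i) ↔
        (∑ i ∈ N.captive J', T.streams i) * (N.capacity univ - ∑ i, T.rho i) <
          (∑ i, T.streams i) * (N.capacity J' - ∑ i ∈ N.captive J', T.rho i)) := by
    intro J' hne
    have hm : 0 < ∑ i ∈ N.captive J', T.streams i := Finset.sum_pos (fun i _ => T.streams_pos i) hne
    have h1 := Finset.sum_add_sum_compl (N.captive J') T.streams
    have h2 := Finset.sum_add_sum_compl (N.captive J') T.rho
    have h3 : N.capacity J' + N.capacity J'ᶜ = N.capacity univ :=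
      Finset.sum_add_sum_compl J' N.cap
    change _ > -((∑ i ∈ (N.captive J')ᶜ, T.streams i) / (∑ i ∈ N.captive J', T.streams i)) * _ ↔ _
    rw [← h1, ← h2, ← h3, gt_iff_lt, neg_mul, neg_lt, div_mul_eq_mul_div, lt_div_iff₀ hm]
    constructor <;> intro h <;> nlinarith
  constructor
  · intro h J' hsc hJ hne
    exact (hform J' hne).2 (h J' hsc.1 hJ)
  · intro h J' hne hJ
    -- Moving the load term to the left writes the criterion as a comparison of sums over types and
    -- over resources. Taking `S = J'` keeps all subsets proper.
    have hsub := sum_captive_lt (N := N) (S := J')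
      (a := fun j => (∑ i, T.streams i) * N.cap j)
      (b := fun i => T.streams i * (N.capacity univ - ∑ i, T.rho i) +
        (∑ i, T.streams i) * T.rho i) ?_ J' Finset.Subset.rfl hne
    · rw [Finset.sum_add_distrib, ← Finset.sum_mul, ← Finset.mul_sum, ← Finset.mul_sum] at hsub
      rw [mul_sub (∑ i, T.streams i), lt_sub_iff_add_lt]
      exact hsub
    · intro J'' hJ'' hsc
      have hJu : J'' ≠ univ := fun he => hJ (Finset.univ_subset_iff.1 (he ▸ hJ''))
      rw [Finset.sum_add_distrib, ← Finset.sum_mul, ← Finset.mul_sum, ← Finset.mul_sum]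
      -- Without captive types the criterion only says that the capacity is positive.
      rcases (N.captive J'').eq_empty_or_nonempty with he | hne'
      · rw [he]
        simpa using mul_pos hM (Finset.sum_pos (fun j _ => N.cap_pos j) hsc.1)
      · have := (hform J'' hne').1 (h J'' hsc hJu hne')
        rw [mul_sub (∑ i, T.streams i), lt_sub_iff_add_lt] at this
        exact this

end Network

end FlowNetwork

theorem mainTheorem6 {I J : Type*} [Fintype I] [Fintype J] [DecidableEq I] [DecidableEq J]
    (N : FlowNetwork.Network I J) (T : FlowNetwork.Traffic I) (U : ℝ → ℝ)
    (hU : FlowNetwork.IsUtility U) (hstab : N.IsStable T) :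
    (∃! s : (I → ℝ) × (I → ℝ), N.IsFluidEquilibrium U T s.1 s.2) ∧
    ∀ n m : I → ℝ, N.IsFluidEquilibrium U T n m →
      (N.IsCompleteResourcePooling U (n + m) ↔
        ∀ J' : Finset J, N.IsStronglyConnected J' → J' ≠ Finset.univ →
          (N.captive J').Nonempty →
          (∑ i ∈ (N.captive J')ᶜ, T.rho i) - N.capacity J'ᶜ >
            -((∑ i ∈ (N.captive J')ᶜ, T.kap i / T.eta i) /
                (∑ i ∈ N.captive J', T.kap i / T.eta i)) *
              (N.capacity J' - ∑ i ∈ N.captive J', T.rho i)) := by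
  refine ⟨hstab.existsUnique_equilibrium hU, fun n m h => ?_⟩
  -- Without flow types pooling holds trivially and the criterion is vacuous.
  cases isEmpty_or_nonempty I
  · exact iff_of_true (Eventually.of_forall fun n' =>
      ⟨0, ⟨⟨0, by simp, by simp, by simp, fun j => by simpa using (N.cap_pos j).le⟩,
        fun x _ => by simp [FlowNetwork.Network.totalUtility],
        isEmptyElim⟩, isEmptyElim⟩)
      fun J' _ _ ⟨i, _⟩ => isEmptyElim i
  · rw [h.isCompleteResourcePooling_iff hU, N.poolingCriterion_iff T]
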